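/- Let $\mathbb{H}$ be a Hadamard manifold (a complete, simply connected, finite-dimensional smooth Riemannian manifold of nonpositive sectional curvature), with exponential maps $\exp_p : T_p\mathbb{H}\to\mathbb{H}$. Let $K\subseteq\mathbb{H}$ be nonempty and geodesically convex, i.e. $\exp_p(t\exp_p^{-1}q)\in K$ for all $p,q\in K$ and $t\in[0,1]$. Let $\Psi=(\Psi_1,\dots,\Psi_m):K\to\mathbb{R}^m$, and let each $\Psi_i$ be extended to a function $\mathbb{H}\to\mathbb{R}\cup\{\pm\infty\}$, again denoted $\Psi_i$. For $p\in K$ and $v\in T_p\mathbb{H}$ put $$\Psi_i^-(p;v)=\liminf_{t\to0^+}\frac{\Psi_i(\exp_p tv)-\Psi_i(p)}{t},\qquad \Psi_i^+(p;v)=\limsup_{t\to0^+}\frac{\Psi_i(\exp_p tv)-\Psi_i(p)}{t}.$$ A convexificator of $\Psi_i$ at $p$ is a closed set $\partial^*_*\Psi_i(p)\subseteq T_p\mathbb{H}$ such that, for all $v\in T_p\mathbb{H}$, $$\Psi_i^-(p;v)\le\sup_{\xi\in\partial^*_*\Psi_i(p)}\langle\xi,v\rangle\quad\text{and}\quad \Psi_i^+(p;v)\ge\inf_{\xi\in\partial^*_*\Psi_i(p)}\langle\xi,v\rangle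 .$$ Suppose that a convexificator $\partial^*_*\Psi_i(p)$ is given for every $i$ and every $p\in K$, and put $\partial^*_*\Psi(p)=\prod_{i=1}^m\partial^*_*\Psi_i(p)$ and $\langle\xi,v\rangle_m=(\langle\xi_1,v\rangle,\dots,\langle\xi_m,v\rangle)$ for $\xi\in\partial^*_*\Psi(p)$. Suppose that $\Psi$ is $\partial^*_*$-convex on $K$: for all $p,q\in K$ and all $\xi\in\partial^*_*\Psi(p)$, $$\Psi(q)-\Psi(p)\geqq\langle\xi,\exp_p^{-1}q\rangle_m\quad\text{(componentwise)}.$$ Let $\bar p\in K$, and suppose that every $\Psi_i:K\to\mathbb{R}$ is locally Lipschitz at $\bar p$ (Lipschitz for the Riemannian distance on a neighbourhood of $\bar p$ in $K$) and that every $\partial^*_*\Psi_i(\bar p)$ is bounded. Then $\bar p$ is a weakly efficient point of the problem of minimizing $\Psi$ over $K$, i.e. $$\Psi(q)-\Psi(\bar p)\notin-\operatorname{int}\mathbb{R}^m_+\quad\text{for all }q\in K,$$ if and only if $\bar p$ solves the Stampacchia weak $\partial^*_*$-vector variational inequality, i.e. for every $q\in K$ there is $\xi\in\partial^*_*\Psi(\bar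 p)$ with $$\langle\xi,\exp_{\bar p}^{-1}q\rangle_m\notin-\operatorname{int}\mathbb{R}^m_+ .$$ -/

import Mathlib

open Set Filter Topology Bundle
open scoped Manifold ContDiff Bundle Pointwise NNReal

noncomputable section

namespace HadamardVVI

/-! ### Riemannian geometry in coordinates

`H` is a smooth manifold modelled on `ℝⁿ`, with a Riemannian metric on its tangent bundle. The chart
around `x : H` is `extChartAt 𝓘(ℝ, E n) x`; `y : E n` denotes a point of the target of that chart. -/

/-- The model space `ℝⁿ`. -/
abbrev E (n : ℕ) : Type := EuclideanSpace ℝ (Fin n)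

section Riemannian

variable {n : ℕ} {H : Type*} [MetricSpace H] [ChartedSpace (E n) H] [IsManifold 𝓘(ℝ, E n) ∞ H]

/-- The tangent space `T_p H`. -/
abbrev Tan (n : ℕ) {H : Type*} [TopologicalSpace H] [ChartedSpace (E n) H] (p : H) : Type :=
  TangentSpace 𝓘(ℝ, E n) p

/-- The coordinate vector `∂_i` of the chart around `x`, at the point with coordinates `y`. -/
def coordVector (x : H) (y : E n) (i : Fin n) : Tan n ((extChartAt 𝓘(ℝ, E n) x).symm y) :=
  mfderiv 𝓘(ℝ, E n) 𝓘(ℝ, E n) (extChartAt 𝓘(ℝ, E n) x).symm y (EuclideanSpace.single i (1 : ℝ))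

/-- The `i`-th partial derivative of a function of the coordinates. -/
def partialDeriv (i : Fin n) (f : E n → ℝ) (y : E n) : ℝ :=
  fderiv ℝ f y (EuclideanSpace.single i (1 : ℝ))

variable [RiemannianBundle (fun p : H ↦ TangentSpace 𝓘(ℝ, E n) p)]

/-- The matrix `g_{ij} = ⟨∂_i, ∂_j⟩` of the metric in the chart around `x`. -/
def metricMatrix (x : H) (y : E n) : Matrix (Fin n) (Fin n) ℝ :=
  Matrix.of fun i j ↦ inner ℝ (coordVector x y i) (coordVector x y j)

/-- The Christoffel symbols of the Levi-Civita connection in the chart around `x`,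
`Γ^k_{ij} = 1/2 ∑_l g^{kl} (∂_i g_{jl} + ∂_j g_{il} - ∂_l g_{ij})`. -/
def christoffel (x : H) (k i j : Fin n) (y : E n) : ℝ :=
  1 / 2 * ∑ l, (metricMatrix x y)⁻¹ k l *
    (partialDeriv i (fun z ↦ metricMatrix x z j l) y
      + partialDeriv j (fun z ↦ metricMatrix x z i l) y
      - partialDeriv l (fun z ↦ metricMatrix x z i j) y)

/-- The components of the curvature tensor in the chart around `x`:
`R(∂_i, ∂_j) ∂_k = ∇_i ∇_j ∂_k - ∇_j ∇_i ∂_k = ∑_l R^l_{ijk} ∂_l`. -/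
def curvatureTensor (x : H) (l i j k : Fin n) (y : E n) : ℝ :=
  partialDeriv i (christoffel x l j k) y - partialDeriv j (christoffel x l i k) y
    + ∑ s, (christoffel x l i s y * christoffel x s j k y
      - christoffel x l j s y * christoffel x s i k y)

/-- The inner product `⟨u, w⟩` of two tangent vectors given by their coordinates. -/
def coordInner (x : H) (y : E n) (u w : Fin n → ℝ) : ℝ :=
  ∑ i, ∑ j, metricMatrix x y i j * u i * w j

/-- The vector `R(u, w) w` in coordinates. -/
def curvatureVector (x : H) (y : E n) (u w : Fin n → ℝ) : Fin n → ℝ :=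
  fun l ↦ ∑ i, ∑ j, ∑ k, curvatureTensor x l i j k y * u i * w j * w k

/-- The sectional curvature `⟨R(u, w) w, u⟩ / (‖u‖² ‖w‖² - ⟨u, w⟩²)` of the plane spanned by the
linearly independent vectors `u`, `w`. -/
def sectionalCurvature (x : H) (y : E n) (u w : Fin n → ℝ) : ℝ :=
  coordInner x y (curvatureVector x y u w) u /
    (coordInner x y u u * coordInner x y w w - coordInner x y u w ^ 2)

variable (n H) in
/-- Hadamard manifolds: complete, simply connected, of nonpositive sectional curvature. -/
structure IsHadamardManifold : Prop where
  complete : CompleteSpace H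
  simplyConnected : SimplyConnectedSpace H
  nonpos : ∀ (x : H), ∀ y ∈ (extChartAt 𝓘(ℝ, E n) x).target, ∀ u w : Fin n → ℝ,
    LinearIndependent ℝ ![u, w] → sectionalCurvature x y u w ≤ 0

variable (n) in
/-- Geodesics `γ : ℝ → H`: smooth curves with `∇_{γ'} γ' = 0`, that is, whose coordinates `c^k` in
each chart satisfy `(c^k)'' + ∑_{i,j} Γ^k_{ij}(c) (c^i)' (c^j)' = 0`. (As `H` is complete, every
geodesic is defined on the whole line.) -/
def IsGeodesic (γ : ℝ → H) : Prop :=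
  ContMDiff 𝓘(ℝ, ℝ) 𝓘(ℝ, E n) ∞ γ ∧
  ∀ (x : H) (t : ℝ), γ t ∈ (chartAt (E n) x).source → ∀ k : Fin n,
    letI c : Fin n → ℝ → ℝ := fun i s ↦ extChartAt 𝓘(ℝ, E n) x (γ s) i
    deriv (deriv (c k)) t
      + ∑ i, ∑ j, christoffel x k i j (extChartAt 𝓘(ℝ, E n) x (γ t)) * deriv (c i) t * deriv (c j) t
      = 0

/-- `γ` is a geodesic with `γ(0) = p` and `γ'(0) = v`. -/
def IsGeodesicFrom (γ : ℝ → H) (p : H) (v : Tan n p) : Prop :=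
  IsGeodesic n γ ∧ γ 0 = p ∧
    HasMFDerivAt 𝓘(ℝ, ℝ) 𝓘(ℝ, E n) γ 0 (ContinuousLinearMap.toSpanSingleton ℝ (v : E n))

open Classical in
/-- The exponential map `exp_p v = γ(1)`, where `γ` is the geodesic with `γ(0) = p`, `γ'(0) = v`
(it exists and is unique when `H` is complete; otherwise the value is `p` if it does not exist). -/
def expMap (p : H) (v : Tan n p) : H :=
  if h : ∃ γ : ℝ → H, IsGeodesicFrom γ p v then h.choose 1 else p

variable (n) in
/-- `exp_p⁻¹ q`, as the fibre of `exp_p` over `q`. On a Hadamard manifold `exp_p` is bijective, so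
this consists of exactly one vector; statements about the vector `exp_p⁻¹ q` are expressed below as
statements about every element of this fibre. -/
def expInv (p q : H) : Set (Tan n p) := {v | expMap p v = q}

variable (n) in
/-- Geodesically convex sets: any two points `p, q` of `K` are joined by a geodesic, and
`exp_p (t exp_p⁻¹ q) ∈ K` for `t ∈ [0, 1]`. -/
def GeodesicallyConvex (K : Set H) : Prop :=
  ∀ p ∈ K, ∀ q ∈ K, (expInv n p q).Nonempty ∧
    ∀ v ∈ expInv n p q, ∀ t ∈ Icc (0 : ℝ) 1, expMap p (t • v) ∈ K

/-! ### Dini derivatives and convexificators -/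

/-- The difference quotient `(f(exp_p (t v)) - f(p)) / t`. -/
def diffQuotient (f : H → EReal) (p : H) (v : Tan n p) (t : ℝ) : EReal :=
  (f (expMap p (t • v)) - f p) / (t : EReal)

/-- The lower Dini directional derivative `f⁻(p; v)`. -/
def lowerDini (f : H → EReal) (p : H) (v : Tan n p) : EReal :=
  liminf (diffQuotient f p v) (𝓝[>] (0 : ℝ))

/-- The upper Dini directional derivative `f⁺(p; v)`. -/
def upperDini (f : H → EReal) (p : H) (v : Tan n p) : EReal :=
  limsup (diffQuotient f p v) (𝓝[>] (0 : ℝ))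

/-- `A` is an upper convexificator of `f` at `p`. -/
def IsUpperConvexificator (f : H → EReal) (p : H) (A : Set (Tan n p)) : Prop :=
  IsClosed A ∧ ∀ v : Tan n p, lowerDini f p v ≤ ⨆ ξ ∈ A, ((inner ℝ ξ v : ℝ) : EReal)

/-- `A` is a lower convexificator of `f` at `p`. -/
def IsLowerConvexificator (f : H → EReal) (p : H) (A : Set (Tan n p)) : Prop :=
  IsClosed A ∧ ∀ v : Tan n p, ⨅ ξ ∈ A, ((inner ℝ ξ v : ℝ) : EReal) ≤ upperDini f p v

/-- `A` is a convexificator of `f` at `p`. -/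
def IsConvexificator (f : H → EReal) (p : H) (A : Set (Tan n p)) : Prop :=
  IsUpperConvexificator f p A ∧ IsLowerConvexificator f p A

/-! ### Vector-valued notions

`D i p` is the chosen convexificator of the `i`-th component at `p`. -/

variable {m : ℕ}

/-- The product `∂Ψ(p) = ∂Ψ_1(p) × ⋯ × ∂Ψ_m(p)`. -/
def prodConvexificator (D : Fin m → (p : H) → Set (Tan n p)) (p : H) : Set (Fin m → Tan n p) :=
  {ξ | ∀ i, ξ i ∈ D i p}

/-- `⟨ξ; v⟩_m = (⟨ξ_1; v⟩, …, ⟨ξ_m; v⟩)`. -/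
def pairing {p : H} (ξ : Fin m → Tan n p) (v : Tan n p) : Fin m → ℝ :=
  fun i ↦ inner ℝ (ξ i) v

/-- `int ℝ^m_+`. -/
def intOrthant (m : ℕ) : Set (Fin m → ℝ) := interior {x | ∀ i, 0 ≤ x i}

/-- The inequality of `∂`-convexity of `Ψ` at `p` over `K`; the order on `ℝ^m` is componentwise. -/
def StarConvexAt (K : Set H) (Ψ : K → Fin m → ℝ) (D : Fin m → (p : H) → Set (Tan n p)) (p : K) :
    Prop :=
  ∀ q : K, ∀ v ∈ expInv n (p : H) q, ∀ ξ ∈ prodConvexificator D (p : H),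
    pairing ξ v ≤ Ψ q - Ψ p

/-- `∂`-convexity of `Ψ` on `K`: `∂`-convexity at each point of `K`. -/
def StarConvexOn (K : Set H) (Ψ : K → Fin m → ℝ) (D : Fin m → (p : H) → Set (Tan n p)) : Prop :=
  ∀ p : K, StarConvexAt K Ψ D p

/-- Solutions of the Stampacchia weak vector variational inequality. -/
def IsStampacchiaWeakSolution (K : Set H) (D : Fin m → (p : H) → Set (Tan n p)) (p : K) : Prop :=
  ∀ q : K, ∀ v ∈ expInv n (p : H) q, ∃ ξ ∈ prodConvexificator D (p : H),
    pairing ξ v ∉ -intOrthant m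

end Riemannian

/-- Weakly efficient points of the problem of minimizing `Ψ` over `K`. -/
def IsWeaklyEfficient {H : Type*} {m : ℕ} (K : Set H) (Ψ : K → Fin m → ℝ) (p : K) : Prop :=
  ∀ q : K, Ψ q - Ψ p ∉ -intOrthant m

/-- `f : K → ℝ` is Lipschitz, for the Riemannian distance, near `p`. -/
def LocallyLipschitzAt {H : Type*} [MetricSpace H] {K : Set H} (f : K → ℝ) (p : K) : Prop :=
  ∃ (L : ℝ≥0), ∃ U ∈ 𝓝 p, LipschitzOnWith L f U

end HadamardVVI

end

open HadamardVVI

namespace HadamardVVI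

/-! A Stampacchia solution is weakly efficient because `∂`-convexity at `pbar` bounds the pairing by
`Ψ q - Ψ pbar`: a strict decrease of all components would make every pairing negative.

For the converse, let `γ` be the geodesic from `pbar` with velocity `v`, and suppose that all
elements of all convexificators at `pbar` are negative on `v`. By compactness each lower Dini
derivative is negative (`lowerDini_neg`), so each component drops below its initial value at
arbitrarily small times. These times may depend on the component. Convexity at intermediate points
removes the dependence (`StarConvexOn.lt_of_between`): a drop at time `s` forces one at all small
times before `s`. Hence all components drop together, against weak efficiency. The argument needs
nonempty convexificators along `γ`; an empty one would make a lower Dini derivative `-∞`, which the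
Lipschitz condition forbids (`nonempty_of_lipschitzOnWith`).

Since `expMap` chooses a geodesic, evaluating it along `γ` rests on `IsGeodesicFrom.unique`, that
is, on ODE uniqueness for the smooth geodesic spray. -/

/-! ### Smoothness of the metric and of the Christoffel symbols in charts -/

theorem contMDiffOn_mfderiv_apply {F G M N : Type*} [NormedAddCommGroup F] [NormedSpace ℝ F]
    [NormedAddCommGroup G] [NormedSpace ℝ G] [TopologicalSpace N] {J : ModelWithCorners ℝ G N}
    [TopologicalSpace M] [ChartedSpace N M] [IsManifold J ∞ M] {f : F → M} {s : Set F}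
    (hs : IsOpen s) (hf : ContMDiffOn 𝓘(ℝ, F) J ∞ f s) (v : F) :
    ContMDiffOn 𝓘(ℝ, F) (J.prod 𝓘(ℝ, G)) ∞
      (fun y ↦ (⟨f y, mfderiv 𝓘(ℝ, F) J f y v⟩ : TangentBundle J M)) s := by
  have h1 := hf.contMDiffOn_tangentMapWithin (m := ∞) (by simp) hs.uniqueMDiffOn
  have h2 : ContMDiff 𝓘(ℝ, F) 𝓘(ℝ, F).tangent ∞
      (fun y : F ↦ (⟨y, v⟩ : TangentBundle 𝓘(ℝ, F) F)) :=
    contMDiff_vectorSpace_iff_contDiff.2 contDiff_const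
  refine (h1.comp h2.contMDiffOn (s := s) (fun y hy ↦ hy)).congr fun y hy ↦ ?_
  simp only [Function.comp, tangentMapWithin, mfderivWithin_of_isOpen hs hy]

theorem contDiffOn_partialDeriv {n : ℕ} {f : E n → ℝ} {s : Set (E n)} (hs : IsOpen s)
    (hf : ContDiffOn ℝ ∞ f s) (i : Fin n) : ContDiffOn ℝ ∞ (partialDeriv i f) s :=
  (hf.fderiv_of_isOpen hs (by simp)).clm_apply contDiffOn_const

theorem contDiffOn_matrix_det {n : ℕ} {F : Type*} [NormedAddCommGroup F] [NormedSpace ℝ F]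
    {A : F → Matrix (Fin n) (Fin n) ℝ} {s : Set F}
    (hA : ∀ i j, ContDiffOn ℝ ∞ (fun y ↦ A y i j) s) : ContDiffOn ℝ ∞ (fun y ↦ (A y).det) s := by
  simp only [Matrix.det_apply]
  exact ContDiffOn.sum fun σ _ ↦ (contDiffOn_prod fun i _ ↦ hA _ _).const_smul _

/-- Cramer's rule: an entry of the adjugate is the determinant of `A y` with one row replaced by a
constant unit vector. -/
theorem contDiffOn_matrix_inv {n : ℕ} {F : Type*} [NormedAddCommGroup F] [NormedSpace ℝ F]
    {A : F → Matrix (Fin n) (Fin n) ℝ} {s : Set F}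
    (hA : ∀ i j, ContDiffOn ℝ ∞ (fun y ↦ A y i j) s) (hdet : ∀ y ∈ s, (A y).det ≠ 0)
    (k l : Fin n) : ContDiffOn ℝ ∞ (fun y ↦ (A y)⁻¹ k l) s := by
  simp only [Matrix.inv_def, Matrix.smul_apply, Ring.inverse_eq_inv', smul_eq_mul,
    Matrix.adjugate_apply]
  refine ((contDiffOn_matrix_det hA).inv hdet).mul (contDiffOn_matrix_det fun i j ↦ ?_)
  by_cases h : i = l
  · subst h
    simpa using contDiffOn_const
  · simpa [Matrix.updateRow_ne h] using hA i j

section Coordinates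

variable {n : ℕ} {H : Type*} [MetricSpace H] [ChartedSpace (E n) H] [IsManifold 𝓘(ℝ, E n) ∞ H]

theorem contMDiffOn_coordVector (x : H) (i : Fin n) :
    ContMDiffOn 𝓘(ℝ, E n) (𝓘(ℝ, E n).prod 𝓘(ℝ, E n)) ∞
      (fun y ↦ (⟨(extChartAt 𝓘(ℝ, E n) x).symm y, coordVector x y i⟩ :
        TotalSpace (E n) (fun p : H ↦ TangentSpace 𝓘(ℝ, E n) p)))
      (extChartAt 𝓘(ℝ, E n) x).target :=
  contMDiffOn_mfderiv_apply (isOpen_extChartAt_target x) (contMDiffOn_extChartAt_symm x)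
    (EuclideanSpace.single i (1 : ℝ))

theorem linearIndependent_coordVector (x : H) {y : E n}
    (hy : y ∈ (extChartAt 𝓘(ℝ, E n) x).target) : LinearIndependent ℝ (coordVector x y) := by
  have h := isInvertible_mfderivWithin_extChartAt_symm hy
  have hinj : Function.Injective
      (mfderiv 𝓘(ℝ, E n) 𝓘(ℝ, E n) (extChartAt 𝓘(ℝ, E n) x).symm y) := by
    rw [modelWithCornersSelf_coe, range_id, mfderivWithin_univ] at h
    exact h.injective
  have hb := (EuclideanSpace.basisFun (Fin n) ℝ).toBasis.linearIndependent
  have := hb.map' (mfderiv 𝓘(ℝ, E n) 𝓘(ℝ, E n) (extChartAt 𝓘(ℝ, E n) x).symm y).toLinearMap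
    (LinearMap.ker_eq_bot.2 hinj)
  convert! this using 1
  ext1 i
  simp only [Function.comp, OrthonormalBasis.coe_toBasis, EuclideanSpace.basisFun_apply]
  rfl

theorem contDiffAt_extChartAt_comp {γ : ℝ → H} (hγ : ContMDiff 𝓘(ℝ, ℝ) 𝓘(ℝ, E n) ∞ γ) (x : H)
    {t : ℝ} (ht : γ t ∈ (chartAt (E n) x).source) :
    ContDiffAt ℝ ∞ (fun s ↦ extChartAt 𝓘(ℝ, E n) x (γ s)) t :=
  ((contMDiffAt_extChartAt' ht).comp t hγ.contMDiffAt).contDiffAt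

variable [RiemannianBundle (fun p : H ↦ TangentSpace 𝓘(ℝ, E n) p)]

theorem det_metricMatrix_ne_zero (x : H) {y : E n}
    (hy : y ∈ (extChartAt 𝓘(ℝ, E n) x).target) : (metricMatrix x y).det ≠ 0 :=
  Matrix.det_gram_ne_zero_iff_linearIndependent.2 (linearIndependent_coordVector x hy)

variable [IsContMDiffRiemannianBundle 𝓘(ℝ, E n) ∞ (E n)
  (fun p : H ↦ TangentSpace 𝓘(ℝ, E n) p)]

theorem contDiffOn_metricMatrix (x : H) (i j : Fin n) :
    ContDiffOn ℝ ∞ (fun y ↦ metricMatrix x y i j) (extChartAt 𝓘(ℝ, E n) x).target :=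
  ((contMDiffOn_coordVector x i).inner_bundle (contMDiffOn_coordVector x j)).contDiffOn

theorem contDiffOn_christoffel (x : H) (k i j : Fin n) :
    ContDiffOn ℝ ∞ (christoffel x k i j) (extChartAt 𝓘(ℝ, E n) x).target := by
  have hpd (a b c : Fin n) := contDiffOn_partialDeriv (isOpen_extChartAt_target x)
    (contDiffOn_metricMatrix x a b) c
  unfold christoffel
  refine contDiffOn_const.mul (ContDiffOn.sum fun l _ ↦ ?_)
  exact (contDiffOn_matrix_inv (contDiffOn_metricMatrix x)
    (fun y hy ↦ det_metricMatrix_ne_zero x hy) k l).mul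
    (((hpd _ _ _).add (hpd _ _ _)).sub (hpd _ _ _))

end Coordinates

/-! ### Geodesics: reparametrization, uniqueness, exponential map -/

theorem deriv_euclidean_apply {n : ℕ} {c : ℝ → E n} {t : ℝ} (hc : DifferentiableAt ℝ c t)
    (k : Fin n) : deriv (fun s ↦ c s k) t = deriv c t k :=
  ((EuclideanSpace.proj (𝕜 := ℝ) k).hasFDerivAt.comp_hasDerivAt t hc.hasDerivAt).deriv

section Geodesics

variable {n : ℕ} {H : Type*} [MetricSpace H] [ChartedSpace (E n) H]

variable (n) in
/-- The velocity of a curve, an element of the tangent space at `γ t`. -/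
noncomputable def velocity (γ : ℝ → H) (t : ℝ) : Tan n (γ t) :=
  deriv (fun s ↦ extChartAt 𝓘(ℝ, E n) (γ t) (γ s)) t

theorem hasMFDerivAt_iff_hasDerivAt {γ : ℝ → H} {t : ℝ} {v : E n} (hγ : ContinuousAt γ t) :
    HasMFDerivAt 𝓘(ℝ, ℝ) 𝓘(ℝ, E n) γ t (ContinuousLinearMap.toSpanSingleton ℝ v) ↔
      HasDerivAt (fun s ↦ extChartAt 𝓘(ℝ, E n) (γ t) (γ s)) v t := by
  simp only [HasMFDerivAt, hγ, true_and, modelWithCornersSelf_coe, range_id, writtenInExtChartAt,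
    extChartAt_model_space_eq_id, PartialEquiv.refl_coe, PartialEquiv.refl_symm, id,
    hasDerivAt_iff_hasFDerivAt]
  exact hasFDerivWithinAt_univ

variable [RiemannianBundle (fun p : H ↦ TangentSpace 𝓘(ℝ, E n) p)]

theorem isGeodesicFrom_iff {γ : ℝ → H} {p : H} {v : Tan n p} :
    IsGeodesicFrom γ p v ↔ IsGeodesic n γ ∧ γ 0 = p ∧
      HasDerivAt (fun s ↦ extChartAt 𝓘(ℝ, E n) p (γ s)) (v : E n) 0 := by
  refine and_congr_right fun hγ ↦ and_congr_right fun h0 ↦ ?_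
  subst h0
  exact hasMFDerivAt_iff_hasDerivAt hγ.1.continuous.continuousAt

theorem IsGeodesicFrom.velocity_zero {γ : ℝ → H} {p : H} {v : Tan n p}
    (hγ : IsGeodesicFrom γ p v) : (velocity n γ 0 : E n) = v := by
  have h := (isGeodesicFrom_iff.1 hγ).2
  obtain ⟨rfl, h⟩ := h
  exact h.deriv

/-- Affine reparametrizations of geodesics are geodesics. -/
theorem IsGeodesic.comp_affine {γ : ℝ → H} (hγ : IsGeodesic n γ) (t a : ℝ) :
    IsGeodesic n (fun s ↦ γ (t + a * s)) := by
  refine ⟨hγ.1.comp (contDiff_const.add (contDiff_const.mul contDiff_id)).contMDiff,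
    fun x s hs k ↦ ?_⟩
  have h1 (c : ℝ → ℝ) (r : ℝ) : deriv (fun s ↦ c (t + a * s)) r = a * deriv c (t + a * r) := by
    rw [deriv_comp_mul_left a (fun u ↦ c (t + u)) r, deriv_comp_const_add, smul_eq_mul]
  have h2 (c : ℝ → ℝ) : deriv (deriv fun s ↦ c (t + a * s)) s
      = a ^ 2 * deriv (deriv c) (t + a * s) := by
    rw [funext (h1 c), deriv_const_mul_field, h1 (deriv c)]
    ring
  have h3 := hγ.2 x (t + a * s) hs k
  simp only [h2 (fun r ↦ extChartAt 𝓘(ℝ, E n) x (γ r) k),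
    fun i ↦ h1 (fun r ↦ extChartAt 𝓘(ℝ, E n) x (γ r) i)]
  rw [← mul_zero (a ^ 2), ← h3, mul_add, Finset.mul_sum]
  simp only [Finset.mul_sum]
  congr 1
  refine Finset.sum_congr rfl fun i _ ↦ Finset.sum_congr rfl fun j _ ↦ ?_
  ring

/-- The geodesic spray in the chart around `x`: the first-order system `(c, c')' = spray (c, c')`
equivalent to the geodesic equation. -/
noncomputable def spray (x : H) (u : E n × E n) : E n × E n :=
  (u.2, WithLp.toLp 2 fun k ↦ -∑ i, ∑ j, christoffel x k i j u.1 * u.2 i * u.2 j)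

variable [IsManifold 𝓘(ℝ, E n) ∞ H]

theorem IsGeodesic.hasDerivAt_spray {γ : ℝ → H} (hγ : IsGeodesic n γ) (x : H) {t : ℝ}
    (ht : γ t ∈ (chartAt (E n) x).source) :
    HasDerivAt (fun s ↦ (extChartAt 𝓘(ℝ, E n) x (γ s),
        deriv (fun r ↦ extChartAt 𝓘(ℝ, E n) x (γ r)) s))
      (spray x (extChartAt 𝓘(ℝ, E n) x (γ t), deriv (fun r ↦ extChartAt 𝓘(ℝ, E n) x (γ r)) t))
      t := by
  set c : ℝ → E n := fun s ↦ extChartAt 𝓘(ℝ, E n) x (γ s)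
  have hcd : ContDiffAt ℝ ∞ c t := contDiffAt_extChartAt_comp hγ.1 x ht
  have hd : DifferentiableAt ℝ c t := hcd.differentiableAt (by simp)
  -- Taking components must commute with the first derivative near `t`, not only at `t`, to be
  -- differentiated again.
  have hev : ∀ᶠ s in 𝓝 t, DifferentiableAt ℝ c s := by
    filter_upwards [(hγ.1.continuous.isOpen_preimage _ (chartAt (E n) x).open_source).mem_nhds ht]
      with s hs using (contDiffAt_extChartAt_comp hγ.1 x hs).differentiableAt (by simp)
  have hdd : DifferentiableAt ℝ (deriv c) t :=
    (hcd.derivWithin (m := ∞) (by simp)).differentiableAt (by simp)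
  refine hd.hasDerivAt.prodMk ?_
  convert hdd.hasDerivAt using 1
  ext k
  have h2 : deriv (deriv fun s ↦ c s k) t = deriv (deriv c) t k := by
    rw [← deriv_euclidean_apply hdd k]
    exact Filter.EventuallyEq.deriv_eq (hev.mono fun s hs ↦ deriv_euclidean_apply hs k)
  have h3 := hγ.2 x t ht k
  rw [← h2]
  change deriv (deriv fun s ↦ c s k) t + ∑ i, ∑ j, christoffel x k i j (c t) *
    deriv (fun s ↦ c s i) t * deriv (fun s ↦ c s j) t = 0 at h3
  simp only [deriv_euclidean_apply hd] at h3
  exact (eq_neg_of_add_eq_zero_left h3).symm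

theorem IsGeodesic.isGeodesicFrom_affine {γ : ℝ → H} (hγ : IsGeodesic n γ) (t a : ℝ) :
    IsGeodesicFrom (fun s ↦ γ (t + a * s)) (γ t) (a • velocity n γ t) := by
  refine isGeodesicFrom_iff.2 ⟨hγ.comp_affine t a, by simp, ?_⟩
  have h := ((contDiffAt_extChartAt_comp hγ.1 (γ t)
    (mem_chart_source (E n) (γ t))).differentiableAt (by simp)).hasDerivAt
  have h' : HasDerivAt (fun s : ℝ ↦ t + a * s) a 0 := by
    simpa using ((hasDerivAt_id (0 : ℝ)).const_mul a).const_add t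
  rw [← add_zero t, ← mul_zero a] at h
  simpa using! h.scomp (0 : ℝ) h'

theorem IsGeodesicFrom.smul {γ : ℝ → H} {p : H} {v : Tan n p} (hγ : IsGeodesicFrom γ p v)
    (a : ℝ) : IsGeodesicFrom (fun s ↦ γ (a * s)) p (a • v) := by
  have hv := hγ.velocity_zero
  have h := hγ.1.isGeodesicFrom_affine 0 a
  obtain ⟨_, rfl, _⟩ := hγ
  change velocity n γ 0 = v at hv
  simpa only [zero_add, hv] using h

/-- Rescaling a geodesic for `a • v` by `a⁻¹` would give one for `v`, so the default value `p`
persists along the ray. -/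
theorem expMap_of_not_exists {p : H} {v : Tan n p} (h : ¬∃ γ : ℝ → H, IsGeodesicFrom γ p v)
    {a : ℝ} (ha : a ≠ 0) : expMap p (a • v) = p := by
  refine dif_neg fun ⟨γ, hγ⟩ ↦ h ⟨fun s ↦ γ (a⁻¹ * s), ?_⟩
  simpa only [inv_smul_smul₀ ha] using hγ.smul a⁻¹

variable [IsContMDiffRiemannianBundle 𝓘(ℝ, E n) ∞ (E n)
  (fun p : H ↦ TangentSpace 𝓘(ℝ, E n) p)]

theorem contDiffAt_spray (x : H) {u : E n × E n}
    (hu : u.1 ∈ (extChartAt 𝓘(ℝ, E n) x).target) : ContDiffAt ℝ ∞ (spray x) u := by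
  have hcoord (i : Fin n) : ContDiffAt ℝ ∞ (fun w : E n × E n ↦ w.2 i) u :=
    (contDiffAt_euclidean.1 contDiffAt_snd) i
  refine contDiffAt_snd.prodMk (contDiffAt_euclidean.2 fun k ↦ ?_)
  refine (ContDiffAt.sum fun i _ ↦ ContDiffAt.sum fun j _ ↦ ?_).neg
  refine (ContDiffAt.mul ?_ (hcoord i)).mul (hcoord j)
  exact ((contDiffOn_christoffel x k i j).contDiffAt
    ((isOpen_extChartAt_target x).mem_nhds hu)).comp u contDiffAt_fst

/-- The spray is smooth, hence Lipschitz near the common initial state, so ODE uniqueness applies to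
position and velocity in the chart; injectivity of the chart returns to `H`. -/
theorem IsGeodesic.eventuallyEq {γ₁ γ₂ : ℝ → H} (h₁ : IsGeodesic n γ₁) (h₂ : IsGeodesic n γ₂)
    {t : ℝ} {x : H} (hx : γ₁ t ∈ (chartAt (E n) x).source) (h : γ₁ t = γ₂ t)
    (hd : deriv (fun s ↦ extChartAt 𝓘(ℝ, E n) x (γ₁ s)) t
      = deriv (fun s ↦ extChartAt 𝓘(ℝ, E n) x (γ₂ s)) t) : γ₁ =ᶠ[𝓝 t] γ₂ := by
  have hsrc {γ : ℝ → H} (hγ : IsGeodesic n γ) (hx : γ t ∈ (chartAt (E n) x).source) :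
      ∀ᶠ s in 𝓝 t, γ s ∈ (chartAt (E n) x).source :=
    (hγ.1.continuous.isOpen_preimage _ (chartAt (E n) x).open_source).mem_nhds hx
  have hx₂ := h ▸ hx
  obtain ⟨K, S, hS, hK⟩ := ((contDiffAt_spray x
    (u := (extChartAt 𝓘(ℝ, E n) x (γ₁ t), deriv (fun s ↦ extChartAt 𝓘(ℝ, E n) x (γ₁ s)) t))
    ((extChartAt 𝓘(ℝ, E n) x).map_source
      (by rwa [extChartAt_source]))).of_le (by simp)).exists_lipschitzOnWith
  have hsol {γ : ℝ → H} (hγ : IsGeodesic n γ) (hx : γ t ∈ (chartAt (E n) x).source)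
      (hS : S ∈ 𝓝 (extChartAt 𝓘(ℝ, E n) x (γ t),
        deriv (fun s ↦ extChartAt 𝓘(ℝ, E n) x (γ s)) t)) :
      ∀ᶠ s in 𝓝 t, HasDerivAt (fun s ↦ (extChartAt 𝓘(ℝ, E n) x (γ s),
        deriv (fun r ↦ extChartAt 𝓘(ℝ, E n) x (γ r)) s))
      (spray x (extChartAt 𝓘(ℝ, E n) x (γ s), deriv (fun r ↦ extChartAt 𝓘(ℝ, E n) x (γ r)) s))
      s ∧ (extChartAt 𝓘(ℝ, E n) x (γ s),
        deriv (fun r ↦ extChartAt 𝓘(ℝ, E n) x (γ r)) s) ∈ S :=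
    ((hsrc hγ hx).mono fun s hs ↦ hγ.hasDerivAt_spray x hs).and
      ((hγ.hasDerivAt_spray x hx).continuousAt hS)
  have key := ODE_solution_unique_of_eventually (v := fun _ ↦ spray x) (s := fun _ ↦ S)
    (.of_forall fun _ ↦ hK) (hsol h₁ hx hS) (hsol h₂ hx₂ (by rwa [← h, ← hd])) (by rw [h, hd])
  filter_upwards [key, hsrc h₁ hx, hsrc h₂ hx₂] with s hs hs₁ hs₂
  exact (extChartAt 𝓘(ℝ, E n) x).injOn (by rwa [extChartAt_source]) (by rwa [extChartAt_source])
    (congrArg Prod.fst hs)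

/-- A geodesic is determined by its germ at one point. -/
theorem IsGeodesic.eq_of_eventuallyEq {γ₁ γ₂ : ℝ → H} (h₁ : IsGeodesic n γ₁)
    (h₂ : IsGeodesic n γ₂) {t : ℝ} (h : γ₁ =ᶠ[𝓝 t] γ₂) : γ₁ = γ₂ := by
  have hclopen : IsClopen {s | γ₁ =ᶠ[𝓝 s] γ₂} := by
    refine ⟨isClosed_of_closure_subset fun s hs ↦ ?_, isOpen_setOfPred_eventually_nhds⟩
    rw [mem_closure_iff_frequently] at hs
    have hcont₁ := h₁.1.continuous
    have hcont₂ := h₂.1.continuous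
    have hs0 : γ₁ s = γ₂ s :=
      (isClosed_eq hcont₁ hcont₂).closure_subset
        (mem_closure_iff_frequently.2 (hs.mono fun r hr ↦ hr.self_of_nhds))
    have hx := mem_chart_source (E n) (γ₁ s)
    have hc₁ := (h₁.hasDerivAt_spray (γ₁ s) hx).continuousAt.snd
    have hc₂ := (h₂.hasDerivAt_spray (γ₁ s) (by rwa [← hs0])).continuousAt.snd
    refine h₁.eventuallyEq h₂ hx hs0 ?_
    -- Velocities that differ at `s` would differ at all nearby times, yet the germs agree at times
    -- arbitrarily close to `s`.
    by_contra hne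
    refine hs (((hc₁.ne_iff_eventually_ne hc₂).1 hne).mono fun r hr hr' ↦ hr ?_)
    exact (hr'.fun_comp (extChartAt 𝓘(ℝ, E n) (γ₁ s))).deriv_eq
  funext s
  have : s ∈ {s | γ₁ =ᶠ[𝓝 s] γ₂} := by
    rw [hclopen.eq_univ ⟨t, h⟩]
    trivial
  exact EventuallyEq.eq_of_nhds this

/-- Uniqueness of the geodesic with given initial point and velocity. -/
theorem IsGeodesicFrom.unique {γ₁ γ₂ : ℝ → H} {p : H} {v : Tan n p}
    (h₁ : IsGeodesicFrom γ₁ p v) (h₂ : IsGeodesicFrom γ₂ p v) : γ₁ = γ₂ := by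
  obtain ⟨g₁, e₁, d₁⟩ := isGeodesicFrom_iff.1 h₁
  obtain ⟨g₂, e₂, d₂⟩ := isGeodesicFrom_iff.1 h₂
  exact g₁.eq_of_eventuallyEq g₂ (t := 0) (g₁.eventuallyEq g₂ (x := p)
    (by rw [e₁]; exact mem_chart_source (E n) p) (e₁.trans e₂.symm) (d₁.deriv.trans d₂.deriv.symm))

theorem IsGeodesicFrom.expMap_eq {γ : ℝ → H} {p : H} {v : Tan n p} (hγ : IsGeodesicFrom γ p v) :
    expMap p v = γ 1 := by
  have h : ∃ γ : ℝ → H, IsGeodesicFrom γ p v := ⟨γ, hγ⟩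
  rw [expMap, dif_pos h, h.choose_spec.unique hγ]

theorem IsGeodesicFrom.expMap_smul {γ : ℝ → H} {p : H} {v : Tan n p}
    (hγ : IsGeodesicFrom γ p v) (a : ℝ) : expMap p (a • v) = γ a := by
  simpa using (hγ.smul a).expMap_eq

theorem IsGeodesic.expMap_smul_velocity {γ : ℝ → H} (hγ : IsGeodesic n γ) (t a : ℝ) :
    expMap (γ t) (a • velocity n γ t : Tan n (γ t)) = γ (t + a) := by
  simpa using (hγ.isGeodesicFrom_affine t a).expMap_eq

/-- Smooth curves are Lipschitz at each time for the Riemannian distance. -/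
theorem eventually_dist_le_of_contMDiff [IsRiemannianManifold 𝓘(ℝ, E n) H] {γ : ℝ → H}
    (hγ : ContMDiff 𝓘(ℝ, ℝ) 𝓘(ℝ, E n) ∞ γ) (t : ℝ) :
    ∃ C : ℝ, ∀ᶠ s in 𝓝 0, dist (γ t) (γ (t + s)) ≤ C * |s| := by
  have : IsContinuousRiemannianBundle (E n) (fun p : H ↦ TangentSpace 𝓘(ℝ, E n) p) := by
    obtain ⟨g, hg, h⟩ := IsContMDiffRiemannianBundle.exists_contMDiff (IB := 𝓘(ℝ, E n)) (n := ∞)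
      (F := E n) (E := fun p : H ↦ TangentSpace 𝓘(ℝ, E n) p)
    exact ⟨g, hg.continuous, h⟩
  have : IsManifold 𝓘(ℝ, E n) 1 H := .of_le (n := ∞) (by simp)
  obtain ⟨C, -, hC⟩ := eventually_riemannianEDist_le_edist_extChartAt 𝓘(ℝ, E n) (γ t)
  have htend : Tendsto (fun s ↦ t + s) (𝓝 0) (𝓝 t) := by
    simpa using (continuous_const_add t).tendsto 0
  have hd := ((contDiffAt_extChartAt_comp hγ (γ t)
    (mem_chart_source (E n) (γ t))).differentiableAt (by simp)).isBigO_sub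
  obtain ⟨B, hB⟩ := hd.bound
  -- `C` compares the Riemannian distance with the chart distance; `B` bounds the speed of the
  -- coordinate curve.
  refine ⟨C * B, ?_⟩
  filter_upwards [htend.eventually hB, htend.eventually (hγ.continuous.continuousAt.eventually hC)]
    with s hs hs'
  rw [← IsRiemannianManifold.out, edist_dist, edist_dist, ← ENNReal.ofReal_coe_nnreal,
    ← ENNReal.ofReal_mul (NNReal.coe_nonneg C), ENNReal.ofReal_le_ofReal_iff (by positivity),
    dist_comm (extChartAt _ _ _), dist_eq_norm] at hs'
  rw [add_sub_cancel_left, Real.norm_eq_abs] at hs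
  calc _ ≤ _ := hs'
    _ ≤ C * (B * |s|) := by gcongr
    _ = _ := by ring

end Geodesics

/-! ### Convexificators and descent along geodesics -/

theorem mem_intOrthant {m : ℕ} {x : Fin m → ℝ} : x ∈ intOrthant m ↔ ∀ i, 0 < x i := by
  have h : {x : Fin m → ℝ | ∀ i, 0 ≤ x i} = Set.pi univ fun _ ↦ Ici 0 := by
    ext
    simp [Pi.le_def]
  rw [intOrthant, h, interior_pi_set finite_univ]
  simp

theorem mem_neg_intOrthant {m : ℕ} {x : Fin m → ℝ} : x ∈ -intOrthant m ↔ ∀ i, x i < 0 := by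
  simp [mem_intOrthant]

section Convexificators

variable {n m : ℕ} {H : Type*} [MetricSpace H] [ChartedSpace (E n) H]
  [RiemannianBundle (fun p : H ↦ TangentSpace 𝓘(ℝ, E n) p)]

/-- If `⟨·, v⟩` is negative on a nonempty bounded upper convexificator, then the lower Dini
derivative in the direction `v` is negative. -/
theorem IsUpperConvexificator.lowerDini_neg {f : H → EReal} {p : H} {A : Set (Tan n p)}
    (hA : IsUpperConvexificator f p A) (hne : A.Nonempty) (hbdd : ∃ R : ℝ, ∀ ξ ∈ A, ‖ξ‖ ≤ R)
    {v : Tan n p} (hv : ∀ ξ ∈ A, inner ℝ ξ v < 0) : lowerDini f p v < 0 := by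
  have : FiniteDimensional ℝ (Tan n p) := inferInstanceAs (FiniteDimensional ℝ (E n))
  have : ProperSpace (Tan n p) := FiniteDimensional.proper ℝ _
  have hcomp : IsCompact A := Metric.isCompact_of_isClosed_isBounded hA.1
    (isBounded_iff_forall_norm_le.2 hbdd)
  -- The supremum is attained, so it is strictly negative and not merely `≤ 0`.
  obtain ⟨ξ, hξ, hmax⟩ := hcomp.exists_isMaxOn hne
    (f := fun ξ ↦ inner ℝ ξ v) (by fun_prop)
  refine (hA.2 v).trans_lt (lt_of_le_of_lt (iSup₂_le fun η hη ↦ ?_)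
    (EReal.coe_neg'.2 (hv ξ hξ)))
  exact EReal.coe_le_coe_iff.2 (hmax hη)

theorem diffQuotient_eq_coe {f : H → EReal} {p : H} {v : Tan n p} {t a b : ℝ}
    (ha : f (expMap p (t • v)) = a) (hb : f p = b) :
    diffQuotient f p v t = ((a - b) / t : ℝ) := by
  rw [diffQuotient, ha, hb]
  norm_cast

/-- The supremum over the empty set is `⊥`, whereas the lower Dini derivative is at least the real
number `c`. -/
theorem IsUpperConvexificator.nonempty_of_le_diffQuotient {f : H → EReal} {p : H}
    {A : Set (Tan n p)} (hA : IsUpperConvexificator f p A) {v : Tan n p} {c : ℝ}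
    (h : ∀ᶠ t in 𝓝[>] (0 : ℝ), (c : EReal) ≤ diffQuotient f p v t) : A.Nonempty := by
  by_contra hne
  rw [not_nonempty_iff_eq_empty] at hne
  have h1 : (c : EReal) ≤ lowerDini f p v := le_liminf_of_le (h := h)
  have h2 := h1.trans (hA.2 v)
  simp [hne] at h2

/-- If `exp_p (t v) = p` for all `t > 0`, then some element of every bounded upper convexificator
is nonnegative on `v`. -/
theorem exists_inner_nonneg_of_expMap_eq_self {f : H → EReal} {p : H} {b : ℝ} (hb : f p = b)
    {A : Set (Tan n p)} (hA : IsUpperConvexificator f p A) (hbdd : ∃ R : ℝ, ∀ ξ ∈ A, ‖ξ‖ ≤ R)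
    {v : Tan n p} (hv : ∀ t : ℝ, 0 < t → expMap p (t • v) = p) : ∃ ξ ∈ A, 0 ≤ inner ℝ ξ v := by
  have h : ∀ᶠ t in 𝓝[>] (0 : ℝ), ((0 : ℝ) : EReal) ≤ diffQuotient f p v t := by
    filter_upwards [self_mem_nhdsWithin] with t ht
    rw [diffQuotient_eq_coe (a := b) (b := b) (by rw [hv t ht, hb]) hb]
    simp
  by_contra! hneg
  have h1 : ((0 : ℝ) : EReal) ≤ lowerDini f p v := le_liminf_of_le (h := h)
  exact h1.not_gt (hA.lowerDini_neg (hA.nonempty_of_le_diffQuotient h) hbdd hneg)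

theorem isWeaklyEfficient_of_isStampacchiaWeakSolution {K : Set H} (hK : GeodesicallyConvex n K)
    {Ψ : K → Fin m → ℝ} {D : Fin m → (p : H) → Set (Tan n p)} {pbar : K}
    (hconv : StarConvexAt K Ψ D pbar) (hS : IsStampacchiaWeakSolution K D pbar) :
    IsWeaklyEfficient K Ψ pbar := by
  intro q hq
  obtain ⟨v, hv⟩ := (hK pbar pbar.2 q q.2).1
  obtain ⟨ξ, hξ, hneg⟩ := hS q v hv
  rw [mem_neg_intOrthant] at hq hneg
  exact hneg fun i ↦ (hconv q v hv ξ hξ i).trans_lt (hq i)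

variable [IsManifold 𝓘(ℝ, E n) ∞ H] [IsContMDiffRiemannianBundle 𝓘(ℝ, E n) ∞ (E n)
  (fun p : H ↦ TangentSpace 𝓘(ℝ, E n) p)]

/-- An upper convexificator of a function that is locally Lipschitz on `K` is nonempty at every
point from which some geodesic runs into `K`. -/
theorem IsUpperConvexificator.nonempty_of_lipschitzOnWith [IsRiemannianManifold 𝓘(ℝ, E n) H]
    {K : Set H} {f : H → EReal} {ψ : K → ℝ} (hf : ∀ p : K, f p = ψ p) {L : ℝ≥0} {U : Set K}
    (hψ : LipschitzOnWith L ψ U) {γ : ℝ → H} (hγ : IsGeodesic n γ) {t : ℝ} (ht : γ t ∈ K)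
    (hU : U ∈ 𝓝 (⟨γ t, ht⟩ : K)) (hK : ∀ᶠ s in 𝓝[>] (0 : ℝ), γ (t + s) ∈ K)
    {A : Set (Tan n (γ t))} (hA : IsUpperConvexificator f (γ t) A) : A.Nonempty := by
  obtain ⟨C, hC⟩ := eventually_dist_le_of_contMDiff hγ.1 t
  rw [nhds_subtype_eq_comap] at hU
  obtain ⟨V, hV, hVU⟩ := hU
  have htend : Tendsto (fun s ↦ γ (t + s)) (𝓝[>] 0) (𝓝 (γ t)) := by
    have : ContinuousAt (fun s ↦ γ (t + s)) 0 :=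
      (hγ.1.continuous.comp (continuous_const_add t)).continuousAt
    simpa [ContinuousAt] using this.tendsto.mono_left (nhdsWithin_le_nhds (s := Ioi 0))
  -- `L` is the Lipschitz constant of `ψ` and `C` that of `γ` at `t`.
  refine hA.nonempty_of_le_diffQuotient (v := velocity n γ t) (c := -(L * C)) ?_
  filter_upwards [hK, htend hV, nhdsWithin_le_nhds hC, self_mem_nhdsWithin] with s hsK hsV hsC hs
  rw [diffQuotient_eq_coe (a := ψ ⟨γ (t + s), hsK⟩) (b := ψ ⟨γ t, ht⟩)
    (by rw [hγ.expMap_smul_velocity]; exact hf ⟨_, hsK⟩) (hf ⟨γ t, ht⟩), EReal.coe_le_coe_iff,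
    le_div_iff₀ hs]
  have hV0 : γ t ∈ V := mem_of_mem_nhds hV
  have h1 := hψ.dist_le_mul _ (hVU (show (⟨γ t, ht⟩ : K) ∈ Subtype.val ⁻¹' V from hV0)) _
    (hVU (show (⟨γ (t + s), hsK⟩ : K) ∈ Subtype.val ⁻¹' V from hsV))
  rw [Real.dist_eq, Subtype.dist_eq] at h1
  rw [abs_of_pos hs] at hsC
  have h2 := mul_le_mul_of_nonneg_left hsC L.2
  have h3 := le_abs_self (ψ ⟨γ t, ht⟩ - ψ ⟨γ (t + s), hsK⟩)
  change (L : ℝ) * _ ≤ L * _ at h2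
  linarith

/-- The `∂`-convexity inequality at a point of a geodesic, in the direction of another of its
points. -/
theorem StarConvexOn.inner_velocity_le {K : Set H} {Ψ : K → Fin m → ℝ}
    {D : Fin m → (p : H) → Set (Tan n p)} (hconv : StarConvexOn K Ψ D) {γ : ℝ → H}
    (hγ : IsGeodesic n γ) {t a : ℝ} (ht : γ t ∈ K) (ha : γ (t + a) ∈ K)
    {ξ : Fin m → Tan n (γ t)} (hξ : ξ ∈ prodConvexificator D (γ t)) (i : Fin m) :
    a * inner ℝ (ξ i) (velocity n γ t) ≤ Ψ ⟨γ (t + a), ha⟩ i - Ψ ⟨γ t, ht⟩ i := by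
  have h := hconv ⟨γ t, ht⟩ ⟨γ (t + a), ha⟩ (a • velocity n γ t)
    (hγ.expMap_smul_velocity t a) ξ hξ i
  rw [← real_inner_smul_right]
  exact h

/-- If a `∂`-convex function decreases between two points of a geodesic, then its values in between
lie below the initial one, provided that the convexificators there are nonempty. -/
theorem StarConvexOn.lt_of_between {K : Set H} {Ψ : K → Fin m → ℝ}
    {D : Fin m → (p : H) → Set (Tan n p)} (hconv : StarConvexOn K Ψ D) {γ : ℝ → H}
    (hγ : IsGeodesic n γ) {r s t : ℝ} (hrt : r < t) (hts : t ≤ s) (hr : γ r ∈ K) (hs : γ s ∈ K)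
    (ht : γ t ∈ K) (hne : (prodConvexificator D (γ t)).Nonempty) {i : Fin m}
    (hlt : Ψ ⟨γ s, hs⟩ i < Ψ ⟨γ r, hr⟩ i) : Ψ ⟨γ t, ht⟩ i < Ψ ⟨γ r, hr⟩ i := by
  obtain ⟨ξ, hξ⟩ := hne
  have h1 := hconv.inner_velocity_le hγ (a := r - t) ht (by simpa) hξ i
  have h2 := hconv.inner_velocity_le hγ (a := s - t) ht (by simpa) hξ i
  simp only [add_sub_cancel] at h1 h2
  -- A negative slope at `t` is compared with the value at `r`, a nonnegative one with the value at
  -- `s`.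
  rcases lt_or_ge (inner ℝ (ξ i) (velocity n γ t)) 0 with h | h
  · nlinarith
  · nlinarith

/-- Along a geodesic of `K` starting at `pbar`, weak efficiency excludes a direction in which all
elements of all convexificators are negative. -/
theorem exists_inner_nonneg_of_isGeodesicFrom [IsRiemannianManifold 𝓘(ℝ, E n) H] {K : Set H}
    {Ψ : K → Fin m → ℝ} {Φ : Fin m → H → EReal}
    (hΦ : ∀ (i : Fin m) (p : K), Φ i p = (Ψ p i : EReal))
    {D : Fin m → (p : H) → Set (Tan n p)}
    (hD : ∀ (i : Fin m) (p : K), IsUpperConvexificator (Φ i) (p : H) (D i p)) {pbar : K}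
    (hLip : ∀ i : Fin m, LocallyLipschitzAt (fun p : K ↦ Ψ p i) pbar)
    (hbdd : ∀ i : Fin m, ∃ R : ℝ, ∀ ξ ∈ D i (pbar : H), ‖ξ‖ ≤ R)
    (hconv : StarConvexOn K Ψ D) (heff : IsWeaklyEfficient K Ψ pbar) {γ : ℝ → H}
    {v : Tan n (pbar : H)} (hγ : IsGeodesicFrom γ pbar v) (hγK : ∀ t ∈ Icc (0 : ℝ) 1, γ t ∈ K) :
    (∀ i, (D i (pbar : H)).Nonempty) ∧ ∃ i, ∃ ξ ∈ D i (pbar : H), 0 ≤ inner ℝ ξ v := by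
  have hg := hγ.1
  have h0 : γ 0 = pbar := hγ.2.1
  have hstay {t : ℝ} (ht : t ∈ Ico (0 : ℝ) 1) : ∀ᶠ s in 𝓝[>] (0 : ℝ), γ (t + s) ∈ K := by
    filter_upwards [Ioo_mem_nhdsGT (sub_pos.2 ht.2)] with s hs
    exact hγK _ ⟨by linarith [ht.1, hs.1], by linarith [hs.2]⟩
  choose L U hU hLU using hLip
  -- The range includes `t = 0`, which yields nonemptiness at `pbar` itself. Each `U i` is also a
  -- neighbourhood of the points of `K` near `pbar`.
  have hne : ∀ᶠ t in 𝓝 (0 : ℝ), t ∈ Ico (0 : ℝ) 1 → ∀ i, (D i (γ t)).Nonempty := by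
    have hU' := eventually_all.2 fun i ↦ eventually_mem_nhds_iff.2 (hU i)
    rw [nhds_subtype_eq_comap, eventually_comap] at hU'
    have hcont : Tendsto γ (𝓝 0) (𝓝 (pbar : H)) := h0 ▸ hg.1.continuous.tendsto 0
    filter_upwards [hcont.eventually hU'] with t ht htI i
    have htK := hγK t ⟨htI.1, htI.2.le⟩
    exact (hD i ⟨γ t, htK⟩).nonempty_of_lipschitzOnWith (hΦ i) (hLU i) hg htK
      (ht ⟨γ t, htK⟩ rfl i) (hstay htI)
  have hne0 (i : Fin m) : (D i (pbar : H)).Nonempty := h0 ▸ hne.self_of_nhds (by simp) i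
  refine ⟨hne0, ?_⟩
  by_contra! hneg
  have hdec (i : Fin m) : ∃ᶠ t in 𝓝[>] (0 : ℝ), ∃ h : γ t ∈ K, Ψ ⟨γ t, h⟩ i < Ψ pbar i := by
    have h := frequently_lt_of_liminf_lt
      (h := (hD i pbar).lowerDini_neg (hne0 i) (hbdd i) (hneg i))
    refine (h.and_eventually (Ioo_mem_nhdsGT zero_lt_one)).mono fun t ⟨ht, htI⟩ ↦ ?_
    have htK := hγK t ⟨htI.1.le, htI.2.le⟩
    refine ⟨htK, ?_⟩
    rw [diffQuotient_eq_coe (a := Ψ ⟨γ t, htK⟩ i) (b := Ψ pbar i)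
      (by rw [hγ.expMap_smul]; exact hΦ i ⟨_, htK⟩) (hΦ i pbar), EReal.coe_neg',
      div_neg_iff] at ht
    rcases ht with ht | ht
    · exact absurd ht.2 htI.1.not_gt
    · linarith [ht.1]
  -- From frequently to eventually: one time `s` of descent controls all small `t < s`.
  have hall (i : Fin m) : ∀ᶠ t in 𝓝[>] (0 : ℝ), ∀ h : γ t ∈ K, Ψ ⟨γ t, h⟩ i < Ψ pbar i := by
    obtain ⟨s, ⟨hs, hlt⟩, hsI⟩ :=
      ((hdec i).and_eventually (Ioo_mem_nhdsGT zero_lt_one)).exists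
    filter_upwards [nhdsWithin_le_nhds hne, Ioo_mem_nhdsGT hsI.1] with t ht htI htK
    have hpbar : (⟨γ 0, by rw [h0]; exact pbar.2⟩ : K) = pbar := Subtype.ext h0
    rw [← hpbar] at hlt ⊢
    choose ξ hξ using ht ⟨htI.1.le, htI.2.trans hsI.2⟩
    exact hconv.lt_of_between hg htI.1 htI.2.le _ hs htK ⟨ξ, hξ⟩ hlt
  obtain ⟨t, ht, htI⟩ := ((eventually_all.2 hall).and (Ioo_mem_nhdsGT zero_lt_one)).exists
  refine heff ⟨γ t, hγK t ⟨htI.1.le, htI.2.le⟩⟩ (mem_neg_intOrthant.2 fun i ↦ ?_)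
  simpa using ht i _

end Convexificators

end HadamardVVI

theorem theorem5p1 {n m : ℕ} {H : Type*} [MetricSpace H] [ChartedSpace (E n) H]
    [IsManifold 𝓘(ℝ, E n) ∞ H] [RiemannianBundle (fun p : H ↦ TangentSpace 𝓘(ℝ, E n) p)]
    [IsContMDiffRiemannianBundle 𝓘(ℝ, E n) ∞ (E n) (fun p : H ↦ TangentSpace 𝓘(ℝ, E n) p)]
    [IsRiemannianManifold 𝓘(ℝ, E n) H]
    (hH : IsHadamardManifold n H)
    (K : Set H) (hK : GeodesicallyConvex n K)
    -- the objective, real-valued on `K`, and a possibly extended-valued extension to `H`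
    (Ψ : K → Fin m → ℝ) (Φ : Fin m → H → EReal)
    (hΦ : ∀ (i : Fin m) (p : K), Φ i p = (Ψ p i : EReal))
    -- the convexificators of the components at the points of `K`
    (D : Fin m → (p : H) → Set (Tan n p))
    (hD : ∀ (i : Fin m) (p : K), IsConvexificator (Φ i) (p : H) (D i p))
    (pbar : K)
    (hLip : ∀ i : Fin m, LocallyLipschitzAt (fun p : K ↦ Ψ p i) pbar)
    (hbdd : ∀ i : Fin m, ∃ R : ℝ, ∀ ξ ∈ D i (pbar : H), ‖ξ‖ ≤ R)
    (hconv : StarConvexOn K Ψ D) :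
    IsWeaklyEfficient K Ψ pbar ↔ IsStampacchiaWeakSolution K D pbar := by
  refine ⟨fun heff q v hv ↦ ?_,
    isWeaklyEfficient_of_isStampacchiaWeakSolution hK (hconv pbar)⟩
  -- One nonnegative component keeps the pairing out of `-intOrthant m`; the other components are
  -- arbitrary but must exist.
  suffices h : (∀ i, (D i (pbar : H)).Nonempty) ∧ ∃ i, ∃ ξ ∈ D i (pbar : H), 0 ≤ inner ℝ ξ v by
    obtain ⟨hne, i, η, hη, hnonneg⟩ := h
    choose ξ hξ using hne
    refine ⟨Function.update ξ i η, fun j ↦ ?_, fun hneg ↦ ?_⟩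
    · rcases eq_or_ne j i with rfl | hj
      · simpa using hη
      · simpa [hj] using hξ j
    · have := mem_neg_intOrthant.1 hneg i
      rw [pairing, Function.update_self] at this
      exact this.not_ge hnonneg
  have hsegment := (hK pbar pbar.2 q q.2).2 v hv
  by_cases hex : ∃ γ : ℝ → H, IsGeodesicFrom γ (pbar : H) v
  · obtain ⟨γ, hγ⟩ := hex
    exact exists_inner_nonneg_of_isGeodesicFrom hΦ (fun i p ↦ (hD i p).1) hLip hbdd hconv heff hγ
      fun t ht ↦ hγ.expMap_smul t ▸ hsegment t ht
  · -- Impossible on complete manifolds by Hopf-Rinow, but the claim holds without this fact.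
    have h (i : Fin m) := exists_inner_nonneg_of_expMap_eq_self (hΦ i pbar) (hD i pbar).1 (hbdd i)
      fun t ht ↦ expMap_of_not_exists hex ht.ne'
    -- For `m = 0` the set `-intOrthant m` is the whole space, so no point is weakly efficient.
    have hm : Nonempty (Fin m) := by
      by_contra hm
      exact heff pbar (mem_neg_intOrthant.2 fun i ↦ (hm ⟨i⟩).elim)
    exact ⟨fun i ↦ let ⟨ξ, hξ, _⟩ := h i; ⟨ξ, hξ⟩, hm.some, h _⟩
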